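/- \textbf{Theorem.} Let $M,N$ be closed connected 3-manifolds, let $L\subset M$ be a tame link (a finite, possibly empty, union of circles with pairwise disjoint solid-torus neighbourhoods), and let $f:N\to M$ be a covering of finite degree $n$ ramified over $L$. That is, $f$ is continuous, it is a covering of degree $n$ over $M\setminus L$, and near each point of $f^{-1}(L)$ it has, in suitable coordinates in $\operatorname{int}D^2\times(-1,1)$ in which $L$ is the axis $\{z=0\}$, the form $(z,t)\mapsto(z^{m},t)$ for some integer $m\ge1$. Let $\mathrm{Gal}(N/M)$ be the group of homeomorphisms $\sigma$ of $N$ with $f\circ\sigma=f$, and assume that $f$ is Galois, i.e. $\mathrm{Gal}(N/M)$ acts transitively on $f^{-1}(x)$ for every $x\in M\setminus L$. Let $K\subset M$ be a knot which is a connected component of $L$ or is disjoint from $L$, let $V_K\cong S^1\times D^2$ be a tubular neighbourhood of $K=S^1\times\{0\}$ with $V_K\cap L\subset K$, and let $b\in\partial V_K$. Let $K_1,\dots,K_r$, $r=r(K)$, be the connected components of $f^{-1}(K)$ and let $V_j$ be the component of $f^{-1}(V_K)$ containing $K_j$. Let $f(K_j)$ be the degree of the covering $f|_{K_j}:K_j\to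 K$ and put $e(K_j)=\#(f^{-1}(b)\cap\partial V_j)/f(K_j)$, where $\partial V_j=V_j\cap f^{-1}(\partial V_K)$. Let $\mathrm{Gal}(K_j/K)$ be the group of covering transformations of $K_j\to K$, and put $$D(K_j)=\{\sigma\in\mathrm{Gal}(N/M)\mid\sigma(K_j)=K_j\},\qquad I(K_j)=\{\sigma\in D(K_j)\mid\sigma|_{K_j}=\mathrm{id}\}.$$ Then $r$ is finite, each $f|_{K_j}:K_j\to K$ is a finite covering, the numbers $e(K_j)$ and $f(K_j)$ are positive integers that do not depend on $j$ (they are denoted by $e(K)$ and $f(K)$), and for every $j$ the sequence $$1\longrightarrow I(K_j)\longrightarrow D(K_j)\longrightarrow\mathrm{Gal}(K_j/K)\longrightarrow1,$$ whose maps are the inclusion and $\sigma\mapsto\sigma|_{K_j}$, is exact. Moreover $$\#I(K_j)=e(K),\qquad \#D(K_j)=e(K)f(K),\qquad n=e(K)f(K)r(K).$$ -/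

import Mathlib

open Set

namespace HilbertKnots

/-- The connected components of a subset `S` of a topological space, as subsets of that space. -/
def components {X : Type*} [TopologicalSpace X] (S : Set X) : Set (Set X) :=
  {C | ∃ x ∈ S, C = connectedComponentIn S x}

theorem components_subset {X : Type*} [TopologicalSpace X] {S C : Set X}
    (hC : C ∈ components S) : C ⊆ S := by
  obtain ⟨x, _, rfl⟩ := hC
  exact connectedComponentIn_subset S x

/-! ### Knots and links -/

/-- A tubular neighbourhood: an embedded solid torus `S¹ × D²` in `X` (`D²` is the closed unit
disk in `ℂ`) such that `S¹ × int D²` is open in `X`. -/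
structure TubularNbhd (X : Type*) [TopologicalSpace X] where
  /-- the parametrization of the solid torus -/
  toFun : Circle × Metric.closedBall (0 : ℂ) 1 → X
  isEmbedding : Topology.IsEmbedding toFun
  isOpen_interior : IsOpen (toFun '' {p | ‖(p.2 : ℂ)‖ < 1})

namespace TubularNbhd

variable {X : Type*} [TopologicalSpace X] (V : TubularNbhd X)

/-- The underlying set of the tubular neighbourhood. -/
def carrier : Set X := range V.toFun

/-- The core `S¹ × {0}`, i.e. the knot of which `V` is a tubular neighbourhood. -/
def core : Set X := V.toFun '' {p | (p.2 : ℂ) = 0}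

/-- The boundary torus `S¹ × ∂D²`. -/
def boundary : Set X := V.toFun '' {p | ‖(p.2 : ℂ)‖ = 1}

end TubularNbhd

/-- A (tame) link: a finite union of circles having pairwise disjoint tubular neighbourhoods. -/
def IsLink {X : Type*} [TopologicalSpace X] (L : Set X) : Prop :=
  ∃ (m : ℕ) (V : Fin m → TubularNbhd X),
    Pairwise (fun i j => Disjoint (V i).carrier (V j).carrier) ∧ L = ⋃ i, (V i).core

/-! ### Branched coverings -/

/-- In suitable coordinates `int D² × (-1, 1)` around `y` and `f y`, the map `f` is
`(z, t) ↦ (z ^ e, t)` for some `e ≥ 1`, and `L` is the axis `z = 0`. -/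
def IsBranchedAt {N M : Type*} [TopologicalSpace N] [TopologicalSpace M]
    (f : N → M) (L : Set M) (y : N) : Prop :=
  ∃ (e : ℕ) (φ : OpenPartialHomeomorph N (ℂ × ℝ)) (ψ : OpenPartialHomeomorph M (ℂ × ℝ)),
    0 < e ∧ y ∈ φ.source ∧ φ y = 0 ∧
    φ.target = Metric.ball (0 : ℂ) 1 ×ˢ Ioo (-1 : ℝ) 1 ∧
    ψ.target = Metric.ball (0 : ℂ) 1 ×ˢ Ioo (-1 : ℝ) 1 ∧
    MapsTo f φ.source ψ.source ∧
    (∀ x ∈ φ.source, ψ (f x) = ((φ x).1 ^ e, (φ x).2)) ∧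
    (∀ z ∈ ψ.source, z ∈ L ↔ (ψ z).1 = 0)

/-- `f : N → M` is a covering of degree `n` ramified over the link `L`. -/
structure IsBranchedCovering {N M : Type*} [TopologicalSpace N] [TopologicalSpace M]
    (f : N → M) (L : Set M) (n : ℕ) : Prop where
  continuous : Continuous f
  isLink : IsLink L
  isCoveringMapOn : IsCoveringMapOn f Lᶜ
  degree : ∀ x ∈ Lᶜ, (f ⁻¹' {x}).encard = n
  isBranchedAt : ∀ y, f y ∈ L → IsBranchedAt f L y

/-- `p : E → B` is an (unramified) covering of finite degree `d`. -/
def IsCoveringOfDegree {E B : Type*} [TopologicalSpace E] [TopologicalSpace B]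
    (p : E → B) (d : ℕ) : Prop :=
  IsCoveringMap p ∧ ∀ x, (p ⁻¹' {x}).encard = d

/-- The group of covering transformations of `E` with respect to a map `p`: the homeomorphisms of
`E` onto itself which commute with `p`. -/
def Gal {E B : Type*} [TopologicalSpace E] (p : E → B) : Subgroup (E ≃ₜ E) where
  carrier := {σ | ∀ y, p (σ y) = p y}
  one_mem' _ := rfl
  mul_mem' {σ τ} hσ hτ y := (hσ (τ y)).trans (hτ y)
  inv_mem' {σ} hσ y := by
    have h := hσ (σ⁻¹ y)
    have h2 : σ (σ⁻¹ y) = y := σ.apply_symm_apply y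
    rw [h2] at h
    exact h.symm

/-- A ramified covering is Galois if its covering transformations permute transitively the points
of each fibre outside of the ramification locus. -/
def IsGaloisOver {N M : Type*} [TopologicalSpace N] (f : N → M) (L : Set M) : Prop :=
  ∀ y y', f y ∉ L → f y' = f y → ∃ σ ∈ Gal f, σ y = y'

/-! ### Decomposition and inertia groups -/

section Groups

variable {N M : Type*} [TopologicalSpace N]

/-- The decomposition group `D(C) = {σ ∈ Gal(N/M) | σ(C) = C}`. -/
def decompositionGroup (f : N → M) (C : Set N) : Subgroup (Gal f) where
  carrier := {σ | (σ : N ≃ₜ N) '' C = C}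
  one_mem' := image_id C
  mul_mem' {σ τ} hσ hτ := by
    change ((σ : N ≃ₜ N) ∘ (τ : N ≃ₜ N)) '' C = C
    rw [image_comp, show (τ : N ≃ₜ N) '' C = C from hτ]
    exact hσ
  inv_mem' {σ} hσ := by
    have h : (σ : N ≃ₜ N) '' C = C := hσ
    change (σ : N ≃ₜ N).symm '' C = C
    rw [Homeomorph.image_symm]
    conv_lhs => rw [← h]
    exact preimage_image_eq C (σ : N ≃ₜ N).injective

/-- The inertia group `I(C) = {σ ∈ D(C) | σ|_C = id_C}`. -/
def inertiaGroup (f : N → M) (C : Set N) : Subgroup (decompositionGroup f C) where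
  carrier := {σ | ∀ y ∈ C, ((σ : Gal f) : N ≃ₜ N) y = y}
  one_mem' _ _ := rfl
  mul_mem' {σ τ} hσ hτ y hy := by
    change ((σ : Gal f) : N ≃ₜ N) (((τ : Gal f) : N ≃ₜ N) y) = y
    rw [hτ y hy, hσ y hy]
  inv_mem' {σ} hσ y hy := by
    change ((σ : Gal f) : N ≃ₜ N).symm y = y
    rw [Homeomorph.symm_apply_eq, hσ y hy]

/-- The homomorphism `D(C) → Gal(C/K)`, `σ ↦ σ|_C`; here `Gal(C/K)` is the group of covering
transformations of the restriction `f|_C`. -/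
def restrictHom (f : N → M) (C : Set N) :
    decompositionGroup f C →* Gal (fun y : C => f y) where
  toFun σ := ⟨(((σ : Gal f) : N ≃ₜ N).image C).trans (Homeomorph.setCongr σ.2),
    fun y => (σ : Gal f).2 y⟩
  map_one' := rfl
  map_mul' _ _ := rfl

@[simp] theorem restrictHom_apply (f : N → M) (C : Set N) (σ : decompositionGroup f C) (y : C) :
    (((restrictHom f C σ : Gal (fun y : C => f y)) : C ≃ₜ C) y : N) =
      ((σ : Gal f) : N ≃ₜ N) y := rfl

end Groups

/-- The sequence `1 → A → B → C → 1` is exact. -/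
def IsShortExact {A B C : Type*} [Group A] [Group B] [Group C] (i : A →* B) (p : B →* C) : Prop :=
  Function.Injective i ∧ i.range = p.ker ∧ Function.Surjective p

/-! ### Ramification index -/

section Ramification

variable {N M : Type*} [TopologicalSpace N] [TopologicalSpace M]

/-- The connected component of `f⁻¹(V)` containing the connected set `C`. -/
def tubeAbove (f : N → M) (V : TubularNbhd M) (C : Set N) : Set N :=
  {y | ∃ x ∈ C, y ∈ connectedComponentIn (f ⁻¹' V.carrier) x}

/-- The set `O_C` of the points of `f⁻¹(b)` lying on the boundary of the component of `f⁻¹(V)`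
which contains `C`, where `b` is a point of `∂V`. The boundary of that component is its
intersection with `f⁻¹(∂V)`. -/
def boundaryFibre (f : N → M) (V : TubularNbhd M) (b : M) (C : Set N) : Set N :=
  {y | f y = b ∧ y ∈ tubeAbove f V C ∩ f ⁻¹' V.boundary}

/-- The ramification index `#O_C / d` of a component `C` of `f⁻¹(K)` whose covering degree over
`K` is `d`. -/
noncomputable def ramificationIndex (f : N → M) (V : TubularNbhd M) (b : M) (C : Set N)
    (d : ℕ) : ℚ :=
  ((boundaryFibre f V b C).ncard : ℚ) / d

end Ramification

end HilbertKnots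

namespace HilbertKnots

open Filter Topology

/-! ### Open maps and connected components -/

/-! Everything is orbit-stabilizer counting for `Gal f`. Off `L` the group acts freely and
transitively on fibres, so it has order `n`; transitivity passes to the fibres over `L` because the
group is finite, `f` is open and the points off `L` are dense (`exists_apply_eq`). Since `f` is open
and `N` compact, every component of the preimage of a closed connected set maps onto that set. Hence
the group permutes the components of `f⁻¹(K)` transitively, and n = #D · r.

On a component `C`, `f` is open onto `K` and locally injective, so `C → K` is a covering and a deck
transformation is determined by one value. This makes `D → Gal(C/K)` surjective, and identifies `I`
with the stabilizer in `D` of any point of `C`; as `D` is transitive on `C ∩ f⁻¹(x)`, #D = #I · d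
with `d` the degree of `C → K`.

Finally `D` acts simply transitively on the boundary fibre, so the ramification index is #D / d =
#I. The geometric input is that a tube above `V` contains only one component of `f⁻¹(K)`
(`component_eq_of_mem_tube`), proved by lifting a radial contraction. -/

theorem exists_mem_connectedComponent_of_isOpenMap {X Y : Type*} [TopologicalSpace X]
    [TopologicalSpace Y] [CompactSpace X] [T2Space X] [T2Space Y] [PreconnectedSpace Y]
    {p : X → Y} (hp : Continuous p) (hpo : IsOpenMap p) (x : X) (b : Y) :
    ∃ y ∈ connectedComponent x, p y = b := by
  by_contra! hcon
  -- In a compact Hausdorff space a component is the intersection of the clopen sets around it. If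
  -- it misses the fibre over `b`, so does one such clopen set, by compactness; but its image is
  -- clopen and nonempty, hence everything.
  have hsub : ∀ y ∈ ⋂ s : { s : Set X // IsClopen s ∧ x ∈ s }, (s : Set X), (p ⁻¹' {b})ᶜ ∈ 𝓝 y := by
    intro y hy
    rw [← connectedComponent_eq_iInter_isClopen] at hy
    exact (isClosed_singleton.preimage hp).isOpen_compl.mem_nhds (hcon y hy)
  have : Nonempty { s : Set X // IsClopen s ∧ x ∈ s } := ⟨⟨univ, isClopen_univ, mem_univ x⟩⟩
  obtain ⟨⟨Z, hZ, hxZ⟩, hZb⟩ := exists_subset_nhds_of_isCompact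
    (V := fun s : { s : Set X // IsClopen s ∧ x ∈ s } => (s : Set X))
    (fun s t => ⟨⟨s ∩ t, s.2.1.inter t.2.1, s.2.2, t.2.2⟩, inter_subset_left, inter_subset_right⟩)
    (fun s => s.2.1.isClosed.isCompact) hsub
  have himg : IsClopen (p '' Z) := ⟨(hZ.isClosed.isCompact.image hp).isClosed, hpo Z hZ.isOpen⟩
  obtain ⟨z, hz, hzb⟩ := himg.eq_univ ⟨p x, x, hxZ, rfl⟩ ▸ mem_univ b
  exact hZb hz hzb

/-- The components of the preimage of a closed connected set `S` under an open map are mapped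
onto `S`. -/
theorem exists_mem_connectedComponentIn_preimage {N M : Type*} [TopologicalSpace N]
    [TopologicalSpace M] [CompactSpace N] [T2Space N] [T2Space M] {f : N → M}
    (hf : Continuous f) (hfo : IsOpenMap f) {S : Set M} (hS : IsClosed S) (hSc : IsPreconnected S)
    {x : N} (hx : f x ∈ S) {b : M} (hb : b ∈ S) :
    ∃ y ∈ connectedComponentIn (f ⁻¹' S) x, f y = b := by
  have : CompactSpace (f ⁻¹' S) := isCompact_iff_compactSpace.mp (hS.preimage hf).isCompact
  have : PreconnectedSpace S := isPreconnected_iff_preconnectedSpace.mp hSc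
  obtain ⟨y, hy, hyb⟩ := exists_mem_connectedComponent_of_isOpenMap
    (hf.restrictPreimage (s := S)) (hfo.restrictPreimage S) ⟨x, hx⟩ ⟨b, hb⟩
  rw [connectedComponentIn_eq_image (show x ∈ f ⁻¹' S from hx)]
  exact ⟨y, mem_image_of_mem _ hy, congrArg Subtype.val hyb⟩

theorem connectedComponentIn_mem_components {X : Type*} [TopologicalSpace X] {S : Set X} {x : X}
    (hx : x ∈ S) : connectedComponentIn S x ∈ components S := ⟨x, hx, rfl⟩

theorem eq_connectedComponentIn_of_mem_components {X : Type*} [TopologicalSpace X] {S C : Set X}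
    (hC : C ∈ components S) {x : X} (hx : x ∈ C) : C = connectedComponentIn S x := by
  obtain ⟨y, _, rfl⟩ := hC
  exact connectedComponentIn_eq hx

theorem components_eq_of_mem {X : Type*} [TopologicalSpace X] {S C C' : Set X}
    (hC : C ∈ components S) (hC' : C' ∈ components S) {x : X} (hx : x ∈ C) (hx' : x ∈ C') :
    C = C' := by
  rw [eq_connectedComponentIn_of_mem_components hC hx,
    eq_connectedComponentIn_of_mem_components hC' hx']

theorem components_nonempty {X : Type*} [TopologicalSpace X] {S C : Set X}
    (hC : C ∈ components S) : C.Nonempty := by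
  obtain ⟨x, hx, rfl⟩ := hC
  exact ⟨x, mem_connectedComponentIn hx⟩

theorem components_isPreconnected {X : Type*} [TopologicalSpace X] {S C : Set X}
    (hC : C ∈ components S) : IsPreconnected C := by
  obtain ⟨x, hx, rfl⟩ := hC
  exact isPreconnected_connectedComponentIn

theorem components_isClosed {X : Type*} [TopologicalSpace X] {S C : Set X} (hS : IsClosed S)
    (hC : C ∈ components S) : IsClosed C := by
  obtain ⟨x, hx, rfl⟩ := hC
  rw [connectedComponentIn_eq_image hx]
  exact hS.isClosedEmbedding_subtypeVal.isClosedMap _ isClosed_connectedComponent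

theorem image_connectedComponentIn_of_preimage_eq {X : Type*} [TopologicalSpace X] {S : Set X}
    (σ : X ≃ₜ X) (hσ : σ ⁻¹' S = S) {x : X} (hx : x ∈ S) :
    σ '' connectedComponentIn S x = connectedComponentIn S (σ x) := by
  rw [σ.image_connectedComponentIn hx]
  congr 1
  conv_lhs => rw [← hσ]
  exact image_preimage_eq S σ.surjective

/-! ### The local form of a branched covering -/

theorem nhds_zero_le_map_pow {e : ℕ} (he : 0 < e) :
    𝓝 (0 : ℂ) ≤ map (fun z : ℂ => z ^ e) (𝓝 0) := by
  intro s hs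
  obtain ⟨ε, hε, hs⟩ := Metric.mem_nhds_iff.mp (mem_map.mp hs)
  refine Metric.mem_nhds_iff.mpr ⟨ε ^ e, pow_pos hε e, fun w hw => ?_⟩
  obtain ⟨z, rfl⟩ := IsAlgClosed.exists_pow_nat_eq w he
  refine hs ?_
  rw [mem_ball_zero_iff, norm_pow] at hw
  exact mem_ball_zero_iff.mpr (lt_of_pow_lt_pow_left₀ e hε.le hw)

/-- The punctured plane is connected, and `Homeomorph.unitBall` carries it to the punctured disc
because it fixes 0. -/
theorem isPreconnected_ball_diff_zero : IsPreconnected (Metric.ball (0 : ℂ) 1 \ {0}) := by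
  have h : IsPreconnected ({0}ᶜ : Set ℂ) :=
    (isConnected_compl_singleton_of_one_lt_rank (by simp) 0).isPreconnected
  have h2 := h.image (fun z : ℂ => ((Homeomorph.unitBall z : Metric.ball (0 : ℂ) 1) : ℂ))
    (by fun_prop)
  convert h2 using 1
  ext w
  constructor
  · rintro ⟨hw, hw0⟩
    refine ⟨Homeomorph.unitBall.symm ⟨w, hw⟩, ?_, by simp⟩
    intro h0
    have := congrArg Homeomorph.unitBall (mem_singleton_iff.mp h0)
    rw [Homeomorph.apply_symm_apply] at this
    exact hw0 (by simpa using congrArg Subtype.val this)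
  · rintro ⟨z, hz, rfl⟩
    refine ⟨Subtype.coe_prop _, fun h0 => hz ?_⟩
    apply Homeomorph.unitBall.injective
    apply Subtype.ext
    simpa using h0

section Branched

variable {N M : Type*} [TopologicalSpace N] [TopologicalSpace M] {f : N → M} {L : Set M} {y : N}

theorem IsBranchedAt.nhds_le_map (h : IsBranchedAt f L y) : 𝓝 (f y) ≤ map f (𝓝 y) := by
  obtain ⟨e, φ, ψ, he, hy, hy0, hφt, hψt, hmaps, hform, hL⟩ := h
  have hfy : f y ∈ ψ.source := hmaps hy
  have hψ0 : ψ (f y) = 0 := by rw [hform y hy, hy0]; simp [he.ne']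
  have hg : 𝓝 (0 : ℂ × ℝ) ≤ map (fun p : ℂ × ℝ => (p.1 ^ e, p.2)) (𝓝 0) := by
    have : map (fun p : ℂ × ℝ => (p.1 ^ e, p.2)) (𝓝 0) =
        map (fun z : ℂ => z ^ e) (𝓝 0) ×ˢ map id (𝓝 (0 : ℝ)) := by
      rw [prod_map_map_eq, ← nhds_prod_eq]; rfl
    rw [this, Filter.map_id, show (0 : ℂ × ℝ) = (0, 0) from rfl, nhds_prod_eq]
    exact Filter.prod_mono (nhds_zero_le_map_pow he) le_rfl
  have hsrc : ∀ᶠ x in 𝓝 y, x ∈ φ.source := φ.open_source.mem_nhds hy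
  have h1 : map ψ (map f (𝓝 y)) = map (fun p : ℂ × ℝ => (p.1 ^ e, p.2)) (map φ (𝓝 y)) := by
    rw [map_map, map_map]
    exact map_congr (hsrc.mono fun x hx => hform x hx)
  rw [φ.map_nhds_eq hy, hy0] at h1
  have h2 : map ψ.symm (map ψ (map f (𝓝 y))) = map f (𝓝 y) := by
    rw [map_map, map_map]
    exact map_congr (hsrc.mono fun x hx => ψ.left_inv (hmaps hx))
  rw [← h2, h1]
  refine le_trans ?_ (map_mono hg)
  have h3 := ψ.symm.map_nhds_eq (x := 0) (by rw [← hψ0]; exact ψ.map_source hfy)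
  rw [h3, ← hψ0, ψ.left_inv hfy]

/-- On the axis the local form is `(0, t) ↦ (0, t)`, whatever the exponent. -/
theorem IsBranchedAt.exists_injOn (h : IsBranchedAt f L y) :
    ∃ W, IsOpen W ∧ y ∈ W ∧ InjOn f (W ∩ f ⁻¹' L) := by
  obtain ⟨e, φ, ψ, he, hy, hy0, hφt, hψt, hmaps, hform, hL⟩ := h
  refine ⟨φ.source, φ.open_source, hy, ?_⟩
  rintro x ⟨hx, hxL⟩ x' ⟨hx', hxL'⟩ hxx
  have h0 : ∀ z ∈ φ.source, f z ∈ L → (φ z).1 = 0 := fun z hz hzL => by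
    have := (hL _ (hmaps hz)).mp hzL
    rw [hform z hz] at this
    exact pow_eq_zero_iff he.ne' |>.mp this
  refine φ.injOn hx hx' (Prod.ext ?_ ?_)
  · rw [h0 x hx hxL, h0 x' hx' hxL']
  · have := congrArg (fun z => (ψ z).2) hxx
    simpa [hform x hx, hform x' hx'] using this

/-- The preimage of `L` has codimension two: it neither separates locally nor has interior. This
lets fixed-point sets be propagated across it. -/
theorem IsBranchedAt.exists_isPreconnected_diff (h : IsBranchedAt f L y) :
    ∃ W, IsOpen W ∧ y ∈ W ∧ IsPreconnected (W \ f ⁻¹' L) ∧ y ∈ closure (f ⁻¹' L)ᶜ := by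
  obtain ⟨e, φ, ψ, he, hy, hy0, hφt, hψt, hmaps, hform, hL⟩ := h
  have h0 : ∀ z ∈ φ.source, f z ∈ L ↔ (φ z).1 = 0 := fun z hz => by
    rw [hL _ (hmaps hz), hform z hz]
    exact pow_eq_zero_iff he.ne'
  refine ⟨φ.source, φ.open_source, hy, ?_, ?_⟩
  · have hT : IsPreconnected ((Metric.ball (0 : ℂ) 1 \ {0}) ×ˢ Ioo (-1 : ℝ) 1) :=
      isPreconnected_ball_diff_zero.prod isPreconnected_Ioo
    have hsub : (Metric.ball (0 : ℂ) 1 \ {0}) ×ˢ Ioo (-1 : ℝ) 1 ⊆ φ.target := by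
      rw [hφt]; exact prod_mono_left sdiff_subset
    have := hT.image φ.symm (φ.symm.continuousOn.mono hsub)
    convert this using 1
    ext x
    constructor
    · rintro ⟨hx, hxL⟩
      refine ⟨φ x, ?_, φ.left_inv hx⟩
      have := φ.map_source hx
      rw [hφt] at this
      exact ⟨⟨this.1, fun hz => hxL ((h0 x hx).mpr hz)⟩, this.2⟩
    · rintro ⟨p, hp, rfl⟩
      have hps := φ.map_target (hsub hp)
      refine ⟨hps, fun hpL => hp.1.2 ?_⟩
      have := (h0 _ hps).mp hpL
      rwa [φ.right_inv (hsub hp)] at this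
  · rw [mem_closure_iff_frequently]
    have hfr : ∃ᶠ p in 𝓝 (0 : ℂ × ℝ), p.1 ≠ 0 := by
      have hd : Dense ({0}ᶜ : Set ℂ) := dense_compl_singleton 0
      have := hd.prod (dense_univ (X := ℝ))
      exact (mem_closure_iff_frequently.mp (this 0)).mono fun p hp => hp.1
    rw [← hy0, ← φ.map_nhds_eq hy] at hfr
    refine ((frequently_map.mp hfr).and_eventually (φ.open_source.mem_nhds hy)).mono ?_
    rintro x ⟨hx, hxs⟩ hxL
    exact hx ((h0 x hxs).mp hxL)

end Branched

/-! ### The action of the covering transformations -/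

/-- Subgroups of homeomorphisms inherit this action, which makes orbit-stabilizer available on
points and, pointwise, on subsets. -/
instance homeomorphMulAction {X : Type*} [TopologicalSpace X] : MulAction (X ≃ₜ X) X where
  smul σ x := σ x
  one_smul _ := rfl
  mul_smul _ _ _ := rfl

theorem TubularNbhd.isCompact_core {X : Type*} [TopologicalSpace X] (V : TubularNbhd X) :
    IsCompact V.core :=
  ((isClosed_singleton (x := (0 : ℂ))).preimage (by fun_prop :
    Continuous fun p : Circle × Metric.closedBall (0 : ℂ) 1 => (p.2 : ℂ))).isCompact.image
    V.isEmbedding.continuous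

section

variable {N M : Type*} [TopologicalSpace N] [TopologicalSpace M] {f : N → M} {L : Set M} {n : ℕ}

theorem IsBranchedCovering.exists_injOn (hf : IsBranchedCovering f L n) {y : N} (hy : f y ∉ L) :
    ∃ W, IsOpen W ∧ y ∈ W ∧ InjOn f W := by
  obtain ⟨e, he, rfl⟩ := hf.isCoveringMapOn.isLocalHomeomorphOn y hy
  exact ⟨e.source, e.open_source, he, e.injOn⟩

theorem IsBranchedCovering.isOpenMap (hf : IsBranchedCovering f L n) : IsOpenMap f := by
  refine IsOpenMap.of_nhds_le fun y => ?_
  by_cases hy : f y ∈ L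
  · exact (hf.isBranchedAt y hy).nhds_le_map
  · obtain ⟨e, he, rfl⟩ := hf.isCoveringMapOn.isLocalHomeomorphOn y hy
    exact (e.map_nhds_eq he).ge

theorem IsBranchedCovering.dense (hf : IsBranchedCovering f L n) : Dense (f ⁻¹' L)ᶜ := by
  intro y
  by_cases hy : f y ∈ L
  · obtain ⟨W, -, -, -, h⟩ := (hf.isBranchedAt y hy).exists_isPreconnected_diff
    exact h
  · exact subset_closure hy

theorem IsBranchedCovering.surjective [CompactSpace N] [Nonempty N] [T2Space M]
    [PreconnectedSpace M] (hf : IsBranchedCovering f L n) : Function.Surjective f := by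
  have h : IsClopen (range f) := ⟨(isCompact_range hf.continuous).isClosed,
    hf.isOpenMap.isOpen_range⟩
  exact range_eq_univ.mp (h.eq_univ (range_nonempty f))

/-- A covering transformation fixing a point outside of the ramification locus is trivial. -/
theorem IsBranchedCovering.eq_one_of_apply_eq [T2Space N] [T2Space M] [PreconnectedSpace N]
    (hf : IsBranchedCovering f L n) {σ : N ≃ₜ N} (hσ : σ ∈ Gal f) {y : N} (hy : f y ∉ L)
    (hσy : σ y = y) : σ = 1 := by
  have hfix : IsClosed {x | σ x = x} := isClosed_eq σ.continuous continuous_id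
  have hreg : ∀ x, f x ∉ L → σ x = x → x ∈ interior {x | σ x = x} := by
    intro x hx hσx
    obtain ⟨W, hWo, hxW, hW⟩ := hf.exists_injOn hx
    refine mem_interior_iff_mem_nhds.mpr ?_
    have h1 : ∀ᶠ z in 𝓝 x, σ z ∈ W :=
      σ.continuous.continuousAt (by rw [hσx]; exact hWo.mem_nhds hxW)
    filter_upwards [h1, hWo.mem_nhds hxW] with z hz hzW
    exact hW hz hzW (hσ z)
  -- The interior of the fixed set is shown to be clopen. At a limit point over `L`, the connected
  -- set `W \ f ⁻¹' L` is covered by this interior and the open set of moved points; it meets the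
  -- former, so it lies in it, and by density all of `W` is fixed.
  have hclosed : IsClosed (interior {x | σ x = x}) := by
    refine isClosed_of_closure_subset fun x hx => ?_
    have hσx : σ x = x := hfix.closure_subset_iff.mpr interior_subset hx
    by_cases hxL : f x ∈ L
    · obtain ⟨W, hWo, hxW, hWc, -⟩ := (hf.isBranchedAt x hxL).exists_isPreconnected_diff
      have hne : ((W \ f ⁻¹' L) ∩ interior {x | σ x = x}).Nonempty := by
        obtain ⟨z, hzW, hz⟩ := mem_closure_iff.mp hx W hWo hxW
        obtain ⟨w, ⟨hwW, hw⟩, hwL⟩ := hf.dense.inter_open_nonempty _ (hWo.inter isOpen_interior)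
          ⟨z, hzW, hz⟩
        exact ⟨w, ⟨hwW, hwL⟩, hw⟩
      have hsub : W \ f ⁻¹' L ⊆ interior {x | σ x = x} := by
        refine hWc.subset_left_of_subset_union isOpen_interior hfix.isOpen_compl
          (disjoint_compl_right.mono_left interior_subset) ?_ hne
        rintro z ⟨-, hzL⟩
        by_cases hz : σ z = z
        · exact Or.inl (hreg z hzL hz)
        · exact Or.inr hz
      have hWsub : W ⊆ {x | σ x = x} := by
        refine (hf.dense.open_subset_closure_inter hWo).trans ?_
        exact hfix.closure_subset_iff.mpr (hsub.trans interior_subset)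
      exact mem_interior.mpr ⟨W, hWsub, hWo, hxW⟩
    · exact hreg x hxL hσx
  have huniv := IsClopen.eq_univ ⟨hclosed, isOpen_interior⟩ ⟨y, hreg y hy hσy⟩
  ext x
  have hx : x ∈ interior {x | σ x = x} := huniv ▸ mem_univ x
  exact (interior_subset hx : x ∈ {x | σ x = x})

theorem orbit_gal_eq {N M : Type*} [TopologicalSpace N] {f : N → M} {L : Set M}
    (hGal : IsGaloisOver f L) {y : N} (hy : f y ∉ L) :
    MulAction.orbit (Gal f) y = f ⁻¹' {f y} := by
  ext y'
  constructor
  · rintro ⟨σ, rfl⟩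
    exact σ.2 y
  · intro h
    obtain ⟨σ, hσ, rfl⟩ := hGal y y' hy h
    exact ⟨⟨σ, hσ⟩, rfl⟩

theorem IsBranchedCovering.stabilizer_eq_bot [T2Space N] [T2Space M] [PreconnectedSpace N]
    (hf : IsBranchedCovering f L n) {y : N} (hy : f y ∉ L) :
    MulAction.stabilizer (Gal f) y = ⊥ := by
  refine (Subgroup.eq_bot_iff_forall _).mpr fun σ hσ => Subtype.ext ?_
  exact hf.eq_one_of_apply_eq σ.2 hy hσ

/-- A fibre off `L` is a torsor under the group. It is taken through an actual point of `N`, so it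
is nonempty and `n` is positive. -/
theorem IsBranchedCovering.card_gal [T2Space N] [T2Space M] [ConnectedSpace N]
    (hf : IsBranchedCovering f L n) (hGal : IsGaloisOver f L) :
    Nat.card (Gal f) = n ∧ 0 < n := by
  obtain ⟨y, hy⟩ := hf.dense.nonempty
  have h1 : (f ⁻¹' {f y}).ncard = n := by rw [ncard, hf.degree (f y) hy]; rfl
  have h2 := MulAction.index_stabilizer (Gal f) y
  rw [hf.stabilizer_eq_bot hy, Subgroup.index_bot, orbit_gal_eq hGal hy, h1] at h2
  refine ⟨h2, Nat.pos_of_ne_zero ?_⟩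
  rintro rfl
  have h3 := hf.degree (f y) hy
  rw [Nat.cast_zero, encard_eq_zero] at h3
  exact (h3 ▸ (rfl : f y = f y) : y ∈ (∅ : Set N))

theorem IsBranchedCovering.finite_gal [T2Space N] [T2Space M] [ConnectedSpace N]
    (hf : IsBranchedCovering f L n) (hGal : IsGaloisOver f L) : Finite (Gal f) := by
  obtain ⟨h, hn⟩ := hf.card_gal hGal
  exact Nat.finite_of_card_ne_zero (h ▸ hn.ne')

/-- The covering transformations act transitively on all fibres, also over the link. -/
theorem IsBranchedCovering.exists_apply_eq [T2Space N] [T2Space M] [ConnectedSpace N]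
    (hf : IsBranchedCovering f L n) (hGal : IsGaloisOver f L) {y y' : N} (h : f y' = f y) :
    ∃ σ : Gal f, (σ : N ≃ₜ N) y = y' := by
  by_contra! hcon
  have := hf.finite_gal hGal
  -- Finitely many separations intersect to neighbourhoods of `y` and `y'` such that no `σ` sends a
  -- point of the first into the second. Openness and density give points of the two, off `L` and in
  -- one fibre, contradicting the Galois property.
  have hsep : ∀ σ : Gal f, ∃ p : Set N × Set N, p.1 ∈ 𝓝 y ∧ p.2 ∈ 𝓝 y' ∧
      ∀ z ∈ p.1, (σ : N ≃ₜ N) z ∉ p.2 := by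
    intro σ
    obtain ⟨U, U', hU, hU', hyU, hyU', hd⟩ := t2_separation (hcon σ)
    refine ⟨((σ : N ≃ₜ N) ⁻¹' U, U'), ?_, hU'.mem_nhds hyU', fun z hz hz' => ?_⟩
    · exact (hU.preimage (σ : N ≃ₜ N).continuous).mem_nhds hyU
    · exact hd.le_bot ⟨hz, hz'⟩
  choose p hp1 hp2 hp using hsep
  have hA : f '' (⋂ σ, (p σ).1) ∈ 𝓝 (f y') := by
    rw [h]
    exact hf.isOpenMap.image_mem_nhds (iInter_mem.mpr hp1)
  have hB : f ⁻¹' (f '' (⋂ σ, (p σ).1)) ∩ ⋂ σ, (p σ).2 ∈ 𝓝 y' :=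
    inter_mem (hf.continuous.continuousAt hA) (iInter_mem.mpr hp2)
  obtain ⟨z', hzL, ⟨z, hz, hzz⟩, hz'⟩ := hf.dense.inter_nhds_nonempty hB
  obtain ⟨σ, hσ, hσz⟩ := hGal z z' (by rw [hzz]; exact hzL) hzz.symm
  exact hp ⟨σ, hσ⟩ z (mem_iInter.mp hz _) (by rw [hσz]; exact mem_iInter.mp hz' _)

end

/-! ### Components of the preimage of a knot -/

theorem isLocalHomeomorph_of_isOpenMap {X Y : Type*} [TopologicalSpace X] [TopologicalSpace Y]
    {p : X → Y} (hp : Continuous p) (hpo : IsOpenMap p)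
    (hinj : ∀ x, ∃ W, IsOpen W ∧ x ∈ W ∧ InjOn p W) : IsLocalHomeomorph p := by
  refine isLocalHomeomorph_iff_isOpenEmbedding_restrict.mpr fun x => ?_
  obtain ⟨W, hWo, hxW, hW⟩ := hinj x
  exact ⟨W, hWo.mem_nhds hxW, .of_continuous_injective_isOpenMap
    (hp.comp continuous_subtype_val) (injOn_iff_injective.mp hW) (hpo.domRestrict hWo)⟩

/-- Every point over `K` has a neighbourhood in which `f` is injective on the preimage of `K`. -/
def IsLocallyInjectiveOver {N M : Type*} [TopologicalSpace N] (f : N → M) (K : Set M) : Prop :=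
  ∀ y, f y ∈ K → ∃ W, IsOpen W ∧ y ∈ W ∧ InjOn f (W ∩ f ⁻¹' K)

theorem gal_preimage_preimage {N M : Type*} [TopologicalSpace N] {f : N → M} {σ : N ≃ₜ N}
    (hσ : σ ∈ Gal f) (S : Set M) : σ ⁻¹' (f ⁻¹' S) = f ⁻¹' S := by
  ext y
  simp only [mem_preimage, show f (σ y) = f y from hσ y]

theorem gal_image_mem_components {N M : Type*} [TopologicalSpace N] {f : N → M} {σ : N ≃ₜ N}
    (hσ : σ ∈ Gal f) {S : Set M} {C : Set N} (hC : C ∈ components (f ⁻¹' S)) :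
    σ '' C ∈ components (f ⁻¹' S) := by
  obtain ⟨x, hx, rfl⟩ := hC
  rw [image_connectedComponentIn_of_preimage_eq σ (gal_preimage_preimage hσ S) hx]
  exact ⟨σ x, by rw [mem_preimage, show f (σ x) = f x from hσ x]; exact hx, rfl⟩

theorem gal_image_eq_of_mem {N M : Type*} [TopologicalSpace N] {f : N → M} {σ : N ≃ₜ N}
    (hσ : σ ∈ Gal f) {S : Set M} {C C' : Set N} (hC : C ∈ components (f ⁻¹' S))
    (hC' : C' ∈ components (f ⁻¹' S)) {y : N} (hy : y ∈ C) (hσy : σ y ∈ C') : σ '' C = C' :=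
  components_eq_of_mem (gal_image_mem_components hσ hC) hC' (mem_image_of_mem _ hy) hσy

section

variable {N M : Type*} [TopologicalSpace N] [TopologicalSpace M] [CompactSpace N] [T2Space N]
  [T2Space M] {f : N → M} {L K : Set M} {n : ℕ} {C : Set N}

theorem IsBranchedCovering.exists_mem_component (hf : IsBranchedCovering f L n)
    (hK : IsClosed K) (hKc : IsPreconnected K) (hC : C ∈ components (f ⁻¹' K)) {x : M}
    (hx : x ∈ K) : ∃ y ∈ C, f y = x := by
  obtain ⟨y, hy, rfl⟩ := hC
  exact exists_mem_connectedComponentIn_preimage hf.continuous hf.isOpenMap hK hKc hy hx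

variable [ConnectedSpace N]

omit [CompactSpace N] in
theorem IsBranchedCovering.finite_fibre (hf : IsBranchedCovering f L n)
    (hGal : IsGaloisOver f L) (x : M) : (f ⁻¹' {x}).Finite := by
  have := hf.finite_gal hGal
  rcases (f ⁻¹' {x}).eq_empty_or_nonempty with h | ⟨y, rfl⟩
  · rw [h]; exact finite_empty
  · refine (finite_range fun σ : Gal f => (σ : N ≃ₜ N) y).subset fun y' hy' => ?_
    exact hf.exists_apply_eq hGal hy'

/-- Every component meets one fixed fibre, which is finite. -/
theorem IsBranchedCovering.finite_components (hf : IsBranchedCovering f L n)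
    (hGal : IsGaloisOver f L) (hK : IsClosed K) (hKc : IsPreconnected K) :
    (components (f ⁻¹' K)).Finite := by
  rcases (components (f ⁻¹' K)).eq_empty_or_nonempty with h | ⟨C₀, hC₀⟩
  · rw [h]; exact finite_empty
  · obtain ⟨y₀, hy₀⟩ := components_nonempty hC₀
    refine ((hf.finite_fibre hGal (f y₀)).image (connectedComponentIn (f ⁻¹' K))).subset ?_
    intro C hC
    obtain ⟨y, hy, hyx⟩ := hf.exists_mem_component hK hKc hC (components_subset hC₀ hy₀)
    exact ⟨y, hyx, (eq_connectedComponentIn_of_mem_components hC hy).symm⟩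

/-- There are finitely many components, all closed, so each is also relatively open. -/
theorem IsBranchedCovering.exists_isOpen_inter_eq_component (hf : IsBranchedCovering f L n)
    (hGal : IsGaloisOver f L) (hK : IsClosed K) (hKc : IsPreconnected K)
    (hC : C ∈ components (f ⁻¹' K)) : ∃ U, IsOpen U ∧ U ∩ f ⁻¹' K = C := by
  have hF : IsClosed (f ⁻¹' K) := hK.preimage hf.continuous
  refine ⟨(⋃₀ (components (f ⁻¹' K) \ {C}))ᶜ, ?_, ?_⟩
  · rw [sUnion_eq_biUnion]
    refine (((hf.finite_components hGal hK hKc).subset sdiff_subset).isClosed_biUnion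
      fun C' hC' => components_isClosed hF hC'.1).isOpen_compl
  · ext y
    constructor
    · rintro ⟨hyU, hyF⟩
      by_contra hyC
      refine hyU ⟨_, ⟨connectedComponentIn_mem_components hyF, ?_⟩, mem_connectedComponentIn hyF⟩
      rintro rfl
      exact hyC (mem_connectedComponentIn hyF)
    · intro hy
      refine ⟨?_, components_subset hC hy⟩
      rintro ⟨C', ⟨hC', hne⟩, hy'⟩
      exact hne (components_eq_of_mem hC' hC hy' hy)

/-- A local homeomorphism from a compact space to a Hausdorff space with connected base is a
covering; openness of the restriction uses that `C` is relatively open in `f⁻¹(K)`. -/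
theorem IsBranchedCovering.isCoveringMap_component (hf : IsBranchedCovering f L n)
    (hGal : IsGaloisOver f L) (hK : IsClosed K) (hKc : IsPreconnected K)
    (hinj : IsLocallyInjectiveOver f K) (hC : C ∈ components (f ⁻¹' K)) :
    IsCoveringMap (fun y : C => (⟨f y, components_subset hC y.2⟩ : K)) := by
  have : CompactSpace C := isCompact_iff_compactSpace.mp
    (components_isClosed (hK.preimage hf.continuous) hC).isCompact
  rw [← isLocalHomeomorph_iff_isCoveringMap]
  refine isLocalHomeomorph_of_isOpenMap
    ((hf.continuous.comp continuous_subtype_val).subtype_mk _) ?_ ?_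
  · obtain ⟨U, hU, hUC⟩ := hf.exists_isOpen_inter_eq_component hGal hK hKc hC
    rintro _ ⟨O, hO, rfl⟩
    refine ⟨f '' (O ∩ U), hf.isOpenMap _ (hO.inter hU), ?_⟩
    ext ⟨x, hx⟩
    constructor
    · rintro ⟨y, ⟨hyO, hyU⟩, hyx⟩
      have hyx : f y = x := hyx
      have hyC : y ∈ C := hUC ▸ ⟨hyU, by rw [mem_preimage, hyx]; exact hx⟩
      exact ⟨⟨y, hyC⟩, hyO, Subtype.ext hyx⟩
    · rintro ⟨⟨y, hyC⟩, hyO, hyx⟩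
      have hyU : y ∈ U ∩ f ⁻¹' K := hUC ▸ hyC
      exact ⟨y, ⟨hyO, hyU.1⟩, congrArg Subtype.val hyx⟩
  · rintro ⟨y, hy⟩
    obtain ⟨W, hWo, hyW, hW⟩ := hinj y (components_subset hC hy)
    refine ⟨Subtype.val ⁻¹' W, hWo.preimage continuous_subtype_val, hyW, ?_⟩
    intro z hz z' hz' hzz
    exact Subtype.ext (hW ⟨hz, components_subset hC z.2⟩ ⟨hz', components_subset hC z'.2⟩
      (congrArg Subtype.val hzz))

/-- Two covering transformations of a component of `f⁻¹(K)` which agree at a point are equal. -/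
theorem IsBranchedCovering.gal_component_ext (hf : IsBranchedCovering f L n)
    (hGal : IsGaloisOver f L) (hK : IsClosed K) (hKc : IsPreconnected K)
    (hinj : IsLocallyInjectiveOver f K) (hC : C ∈ components (f ⁻¹' K))
    {σ τ : Gal (fun y : C => f y)} {y : C} (h : (σ : C ≃ₜ C) y = (τ : C ≃ₜ C) y) : σ = τ := by
  have : PreconnectedSpace C :=
    isPreconnected_iff_preconnectedSpace.mp (components_isPreconnected hC)
  have hcov := hf.isCoveringMap_component hGal hK hKc hinj hC
  refine Subtype.ext (DFunLike.coe_injective ?_)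
  -- Both maps lift the projection `C → K` through itself, and lifts from a connected space that
  -- agree at a point coincide.
  refine hcov.eq_of_comp_eq (σ : C ≃ₜ C).continuous (τ : C ≃ₜ C).continuous ?_ y h
  funext z
  exact Subtype.ext ((σ.2 z).trans (τ.2 z).symm)

omit [CompactSpace N] in
theorem IsBranchedCovering.exists_decompositionGroup_apply_eq (hf : IsBranchedCovering f L n)
    (hGal : IsGaloisOver f L) (hC : C ∈ components (f ⁻¹' K)) {y y' : N} (hy : y ∈ C)
    (hy' : y' ∈ C) (h : f y' = f y) :
    ∃ σ : decompositionGroup f C, ((σ : Gal f) : N ≃ₜ N) y = y' := by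
  obtain ⟨σ, rfl⟩ := hf.exists_apply_eq hGal h
  exact ⟨⟨σ, gal_image_eq_of_mem σ.2 hC hC hy hy'⟩, rfl⟩

theorem IsBranchedCovering.restrictHom_surjective (hf : IsBranchedCovering f L n)
    (hGal : IsGaloisOver f L) (hK : IsClosed K) (hKc : IsPreconnected K)
    (hinj : IsLocallyInjectiveOver f K) (hC : C ∈ components (f ⁻¹' K)) :
    Function.Surjective (restrictHom f C) := by
  intro τ
  obtain ⟨y, hy⟩ := components_nonempty hC
  obtain ⟨σ, hσ⟩ := hf.exists_decompositionGroup_apply_eq hGal hC hy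
    ((τ : C ≃ₜ C) ⟨y, hy⟩).2 (τ.2 ⟨y, hy⟩)
  refine ⟨σ, hf.gal_component_ext hGal hK hKc hinj hC (y := ⟨y, hy⟩) (Subtype.ext ?_)⟩
  rw [restrictHom_apply, hσ]

theorem range_subtype_inertiaGroup_eq_ker {N M : Type*} [TopologicalSpace N] (f : N → M)
    (C : Set N) : (inertiaGroup f C).subtype.range = (restrictHom f C).ker := by
  rw [Subgroup.range_subtype]
  ext σ
  rw [MonoidHom.mem_ker]
  constructor
  · intro hσ
    refine Subtype.ext (Homeomorph.ext fun y => Subtype.ext ?_)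
    rw [restrictHom_apply]
    exact hσ y y.2
  · intro hσ y hy
    rw [← restrictHom_apply f C σ ⟨y, hy⟩, hσ]
    rfl

/-- An element fixing one point of `C` restricts to a deck transformation agreeing there with the
identity, hence to the identity. -/
theorem IsBranchedCovering.stabilizer_eq_inertiaGroup (hf : IsBranchedCovering f L n)
    (hGal : IsGaloisOver f L) (hK : IsClosed K) (hKc : IsPreconnected K)
    (hinj : IsLocallyInjectiveOver f K) (hC : C ∈ components (f ⁻¹' K)) {y : N} (hy : y ∈ C) :
    MulAction.stabilizer (decompositionGroup f C) y = inertiaGroup f C := by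
  ext σ
  constructor
  · intro hσ
    have h : restrictHom f C σ = 1 :=
      hf.gal_component_ext hGal hK hKc hinj hC (y := ⟨y, hy⟩) (Subtype.ext hσ)
    rwa [← MonoidHom.mem_ker, ← range_subtype_inertiaGroup_eq_ker, Subgroup.range_subtype] at h
  · intro hσ
    exact hσ y hy

omit [CompactSpace N] in
theorem IsBranchedCovering.orbit_decompositionGroup (hf : IsBranchedCovering f L n)
    (hGal : IsGaloisOver f L) (hC : C ∈ components (f ⁻¹' K)) {y : N} (hy : y ∈ C) :
    MulAction.orbit (decompositionGroup f C) y = C ∩ f ⁻¹' {f y} := by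
  ext y'
  constructor
  · rintro ⟨σ, rfl⟩
    have h : ((σ : Gal f) : N ≃ₜ N) '' C = C := σ.2
    exact ⟨h.subset (mem_image_of_mem _ hy), (σ : Gal f).2 y⟩
  · rintro ⟨hy', h⟩
    obtain ⟨σ, rfl⟩ := hf.exists_decompositionGroup_apply_eq hGal hC hy hy' h
    exact ⟨σ, rfl⟩

theorem IsBranchedCovering.card_inertiaGroup_mul (hf : IsBranchedCovering f L n)
    (hGal : IsGaloisOver f L) (hK : IsClosed K) (hKc : IsPreconnected K)
    (hinj : IsLocallyInjectiveOver f K) (hC : C ∈ components (f ⁻¹' K)) {x : M} (hx : x ∈ K) :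
    Nat.card (inertiaGroup f C) * (C ∩ f ⁻¹' {x}).ncard = Nat.card (decompositionGroup f C) := by
  obtain ⟨y, hy, rfl⟩ := hf.exists_mem_component hK hKc hC hx
  rw [← hf.orbit_decompositionGroup hGal hC hy, ← MulAction.index_stabilizer,
    hf.stabilizer_eq_inertiaGroup hGal hK hKc hinj hC hy, Subgroup.card_mul_index]

/-- Both components have points over the same point of `K`, and the group is transitive on that
fibre. -/
theorem IsBranchedCovering.exists_gal_image_eq (hf : IsBranchedCovering f L n)
    (hGal : IsGaloisOver f L) (hK : IsClosed K) (hKc : IsPreconnected K) {C' : Set N}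
    (hC : C ∈ components (f ⁻¹' K)) (hC' : C' ∈ components (f ⁻¹' K)) :
    ∃ σ : Gal f, (σ : N ≃ₜ N) '' C = C' := by
  obtain ⟨y, hy⟩ := components_nonempty hC
  obtain ⟨y', hy', h⟩ := hf.exists_mem_component hK hKc hC' (components_subset hC hy)
  obtain ⟨σ, rfl⟩ := hf.exists_apply_eq hGal h
  exact ⟨σ, gal_image_eq_of_mem σ.2 hC hC' hy hy'⟩

open scoped Pointwise in
theorem IsBranchedCovering.card_decompositionGroup_mul (hf : IsBranchedCovering f L n)
    (hGal : IsGaloisOver f L) (hK : IsClosed K) (hKc : IsPreconnected K)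
    (hC : C ∈ components (f ⁻¹' K)) :
    Nat.card (decompositionGroup f C) * (components (f ⁻¹' K)).ncard = n := by
  have hst : MulAction.stabilizer (Gal f) C = decompositionGroup f C := rfl
  have horb : MulAction.orbit (Gal f) C = components (f ⁻¹' K) := by
    ext C'
    constructor
    · rintro ⟨σ, rfl⟩
      exact gal_image_mem_components σ.2 hC
    · intro hC'
      exact hf.exists_gal_image_eq hGal hK hKc hC hC'
  rw [← horb, ← MulAction.index_stabilizer, hst, Subgroup.card_mul_index, (hf.card_gal hGal).1]

theorem IsBranchedCovering.ncard_component_inter_fibre (hf : IsBranchedCovering f L n)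
    (hGal : IsGaloisOver f L) (hK : IsClosed K) (hKc : IsPreconnected K) {C' : Set N}
    (hC : C ∈ components (f ⁻¹' K)) (hC' : C' ∈ components (f ⁻¹' K)) (x : M) :
    (C' ∩ f ⁻¹' {x}).ncard = (C ∩ f ⁻¹' {x}).ncard := by
  obtain ⟨σ, rfl⟩ := hf.exists_gal_image_eq hGal hK hKc hC hC'
  rw [← ncard_image_of_injective (C ∩ f ⁻¹' {x}) (σ : N ≃ₜ N).injective,
    image_inter (σ : N ≃ₜ N).injective]
  congr 2
  conv_lhs => rw [← image_preimage_eq (f ⁻¹' {x}) (σ : N ≃ₜ N).surjective,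
    gal_preimage_preimage σ.2]

end

/-! ### Tubular neighbourhoods and their preimages -/

namespace TubularNbhd

variable {X : Type*} [TopologicalSpace X] (V : TubularNbhd X)

theorem isCompact_carrier : IsCompact V.carrier := isCompact_range V.isEmbedding.continuous

theorem isPreconnected_closedBall : IsPreconnected (Metric.closedBall (0 : ℂ) 1) :=
  (convex_closedBall (0 : ℂ) 1).isPreconnected

instance : PreconnectedSpace (Metric.closedBall (0 : ℂ) 1) :=
  isPreconnected_iff_preconnectedSpace.mp isPreconnected_closedBall

instance : PreconnectedSpace Circle :=
  Circle.exp_surjective.denseRange.preconnectedSpace Circle.exp.continuous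

theorem isPreconnected_carrier : IsPreconnected V.carrier :=
  isPreconnected_range V.isEmbedding.continuous

theorem core_eq_range :
    V.core = range fun θ : Circle => V.toFun (θ, ⟨0, Metric.mem_closedBall_self zero_le_one⟩) := by
  ext x
  constructor
  · rintro ⟨⟨θ, z⟩, hz, rfl⟩
    exact ⟨θ, congrArg V.toFun (Prod.ext rfl (Subtype.ext (Eq.symm hz)))⟩
  · rintro ⟨θ, rfl⟩
    exact ⟨_, rfl, rfl⟩

theorem isPreconnected_core : IsPreconnected V.core := by
  rw [core_eq_range]
  exact isPreconnected_range (V.isEmbedding.continuous.comp (by fun_prop))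

theorem core_nonempty : V.core.Nonempty := by
  rw [core_eq_range]
  exact range_nonempty _

theorem core_subset_carrier : V.core ⊆ V.carrier := image_subset_range _ _

theorem boundary_subset_carrier : V.boundary ⊆ V.carrier := image_subset_range _ _

theorem toFun_mem_core {p : Circle × Metric.closedBall (0 : ℂ) 1} :
    V.toFun p ∈ V.core ↔ (p.2 : ℂ) = 0 :=
  V.isEmbedding.injective.mem_set_image

theorem disjoint_boundary_core : Disjoint V.boundary V.core := by
  rw [disjoint_left]
  rintro _ ⟨p, hp, rfl⟩ h
  have hp : ‖(p.2 : ℂ)‖ = 1 := hp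
  rw [V.toFun_mem_core.mp h, norm_zero] at hp
  exact zero_ne_one hp

/-- The coordinates in `S¹ × D²` of a point of the tubular neighbourhood. -/
noncomputable def coord : V.carrier ≃ₜ Circle × Metric.closedBall (0 : ℂ) 1 :=
  V.isEmbedding.toHomeomorph.symm

theorem toFun_coord (x : V.carrier) : V.toFun (V.coord x) = x :=
  congrArg Subtype.val (V.isEmbedding.toHomeomorph.apply_symm_apply x)

/-- The distance of a point of the tubular neighbourhood to the core. -/
noncomputable def radius (x : V.carrier) : ℝ := ‖((V.coord x).2 : ℂ)‖

theorem continuous_radius : Continuous V.radius := by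
  unfold radius
  have := V.coord.continuous
  fun_prop

theorem radius_le_one (x : V.carrier) : V.radius x ≤ 1 :=
  mem_closedBall_zero_iff.mp (V.coord x).2.2

theorem radius_eq_zero_iff {x : V.carrier} : V.radius x = 0 ↔ (x : X) ∈ V.core := by
  rw [radius, norm_eq_zero, ← V.toFun_mem_core, toFun_coord]

theorem radius_mk (p : Circle × Metric.closedBall (0 : ℂ) 1) (h : V.toFun p ∈ V.carrier) :
    V.radius ⟨V.toFun p, h⟩ = ‖(p.2 : ℂ)‖ := by
  have : V.coord ⟨V.toFun p, h⟩ = p := V.isEmbedding.injective (V.toFun_coord _)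
  rw [radius, this]

end TubularNbhd

/-- The radial rescaling of a nonzero vector to norm `r`. -/
noncomputable def rescale (r : ℝ) (z : ℂ) : ℂ := ((r / ‖z‖ : ℝ) : ℂ) * z

theorem norm_rescale {r : ℝ} (hr : 0 ≤ r) {z : ℂ} (hz : z ≠ 0) : ‖rescale r z‖ = r := by
  have : ‖z‖ ≠ 0 := norm_ne_zero_iff.mpr hz
  rw [rescale, norm_mul, Complex.norm_real, Real.norm_of_nonneg (by positivity)]
  field_simp

theorem rescale_norm_self {z : ℂ} (hz : z ≠ 0) : rescale ‖z‖ z = z := by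
  rw [rescale, div_self (norm_ne_zero_iff.mpr hz), Complex.ofReal_one, one_mul]

/-! ### Radial contraction of tubes and uniqueness of the core component -/

section

variable {N M : Type*} [TopologicalSpace N] [TopologicalSpace M] {f : N → M} {L : Set M} {n : ℕ}

open scoped unitInterval

/-- The preimage of a tubular neighbourhood can be shrunk radially to the preimage of a smaller
tubular neighbourhood, the points of which remain fixed. -/
theorem IsBranchedCovering.exists_radial_retraction (hf : IsBranchedCovering f L n)
    (V : TubularNbhd M) (hVL : V.carrier ∩ L ⊆ V.core) {s : ℝ} (hs : 0 < s) (hs1 : s ≤ 1) :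
    ∃ ρ : f ⁻¹' V.carrier → N, Continuous ρ ∧
      (∀ y, ∃ h : f (ρ y) ∈ V.carrier, V.radius ⟨f (ρ y), h⟩ ≤ s) ∧
      ∀ y : f ⁻¹' V.carrier, V.radius ⟨f y, y.2⟩ ≤ s → ρ y = y := by
  let pr : f ⁻¹' V.carrier → V.carrier := fun y => ⟨f y, y.2⟩
  have hpr : Continuous pr := (hf.continuous.comp continuous_subtype_val).subtype_mk _
  let R : f ⁻¹' V.carrier → ℝ := fun y => V.radius (pr y)
  have hR : Continuous R := V.continuous_radius.comp hpr
  -- Only the part of radius at least `s` is moved. It and its whole radial homotopy avoid the core,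
  -- hence `L`, so the homotopy lifts through the covering.
  let A : Set (f ⁻¹' V.carrier) := {y | s ≤ R y}
  have hA : IsClosed A := isClosed_le continuous_const hR
  let θ : A → Circle := fun a => (V.coord (pr a)).1
  let z : A → ℂ := fun a => (V.coord (pr a)).2
  have hθ : Continuous θ := by
    have := V.coord.continuous.comp (hpr.comp (continuous_subtype_val (p := (· ∈ A))))
    exact this.fst
  have hz : Continuous z := by
    have := V.coord.continuous.comp (hpr.comp (continuous_subtype_val (p := (· ∈ A))))
    exact continuous_subtype_val.comp this.snd
  have hzs : ∀ a, s ≤ ‖z a‖ := fun a => a.2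
  have hz0 : ∀ a, z a ≠ 0 := fun a => norm_pos_iff.mp (hs.trans_le (hzs a))
  have hz1 : ∀ a, ‖z a‖ ≤ 1 := fun a => V.radius_le_one _
  -- Interpolates linearly from the radius at time 0 to `s` at time 1, staying in `[s, 1]`.
  let rad : I × A → ℝ := fun q => (1 - (q.1 : ℝ)) * ‖z q.2‖ + q.1 * s
  have hrads : ∀ q, s ≤ rad q := fun q => by
    have h1 := q.1.2.1
    have h2 := q.1.2.2
    have := mul_le_mul_of_nonneg_left (hzs q.2) (sub_nonneg.mpr h2)
    simp only [rad]; linarith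
  have hrad0 : ∀ q, 0 < rad q := fun q => hs.trans_le (hrads q)
  have hrad1 : ∀ q, rad q ≤ 1 := fun q => by
    have h1 := q.1.2.1
    have h2 := q.1.2.2
    have h3 := mul_le_mul_of_nonneg_left (hz1 q.2) (sub_nonneg.mpr h2)
    have h4 := mul_le_mul_of_nonneg_left hs1 h1
    simp only [rad]; linarith
  have hradc : Continuous rad := by fun_prop
  have hnorm : ∀ q, ‖rescale (rad q) (z q.2)‖ = rad q := fun q =>
    norm_rescale (hrad0 q).le (hz0 q.2)
  have hresc : Continuous fun q : I × A => rescale (rad q) (z q.2) := by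
    unfold rescale
    have : Continuous fun q : I × A => rad q / ‖z q.2‖ :=
      hradc.div (by fun_prop) fun q => norm_ne_zero_iff.mpr (hz0 q.2)
    fun_prop
  let P : I × A → Circle × Metric.closedBall (0 : ℂ) 1 := fun q =>
    (θ q.2, ⟨rescale (rad q) (z q.2), mem_closedBall_zero_iff.mpr ((hnorm q).trans_le (hrad1 q))⟩)
  have hP : Continuous P := (hθ.comp continuous_snd).prodMk (hresc.subtype_mk _)
  have hPL : ∀ q, V.toFun (P q) ∉ L := fun q hq => by
    have h0 := V.toFun_mem_core.mp (hVL ⟨mem_range_self _, hq⟩)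
    have := hnorm q
    rw [show rescale (rad q) (z q.2) = 0 from h0, norm_zero] at this
    exact (hrad0 q).ne this
  have hPeq : ∀ q : I × A, rad q = ‖z q.2‖ → V.toFun (P q) = f q.2 := fun q hq => by
    have h1 : P q = V.coord (pr q.2) := by
      refine Prod.ext rfl (Subtype.ext ?_)
      change rescale (rad q) (z q.2) = z q.2
      rw [hq, rescale_norm_self (hz0 _)]
    rw [h1, V.toFun_coord]
  have hcov := hf.isCoveringMapOn.isCoveringMap_restrictPreimage
  have hrad_zero : ∀ a, rad (0, a) = ‖z a‖ := fun a => by simp [rad]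
  let H : C(I × A, (Lᶜ : Set M)) :=
    ⟨fun q => ⟨V.toFun (P q), hPL q⟩, (V.isEmbedding.continuous.comp hP).subtype_mk _⟩
  have hAL : ∀ a : A, f a ∉ L := fun a => by
    rw [← hPeq (0, a) (hrad_zero a)]; exact hPL _
  let f₀ : C(A, f ⁻¹' Lᶜ) :=
    ⟨fun a => ⟨a.1, hAL a⟩, (continuous_subtype_val.comp continuous_subtype_val).subtype_mk hAL⟩
  have H0 : ∀ a, H (0, a) = Lᶜ.restrictPreimage f (f₀ a) := fun a =>
    Subtype.ext (hPeq (0, a) (hrad_zero a))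
  let Φ := hcov.liftHomotopy H f₀ H0
  have hΦ : ∀ q, Lᶜ.restrictPreimage f (Φ q) = H q := congrFun (hcov.liftHomotopy_lifts H f₀ H0)
  have hΦ' : ∀ q, f (Φ q) = V.toFun (P q) := fun q => congrArg Subtype.val (hΦ q)
  -- At radius exactly `s` the homotopy downstairs is constant, so its lift is too; the lift thus
  -- glues with the identity on the inner part.
  have hfix : ∀ a : A, R a = s → ((Φ (1, a) : f ⁻¹' Lᶜ) : N) = a := fun a ha => by
    have hconst : ∀ t, rad (t, a) = ‖z a‖ := fun t => by
      have : ‖z a‖ = s := ha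
      simp only [rad, this]; ring
    have h1 : Φ (1, a) = Φ (0, a) := by
      refine hcov.const_of_comp (g := fun t : I => Φ (t, a)) (by fun_prop) (fun t t' => ?_) 1 0
      rw [hΦ, hΦ]
      exact Subtype.ext ((hPeq (t, a) (hconst t)).trans (hPeq (t', a) (hconst t')).symm)
    rw [h1, hcov.liftHomotopy_zero H f₀ H0 a]
    rfl
  classical
  refine ⟨fun y => if h : y ∈ A then (Φ (1, ⟨y, h⟩) : f ⁻¹' Lᶜ) else (y : N), ?_, ?_, ?_⟩
  · rw [← continuousOn_univ]
    have huniv : (univ : Set (f ⁻¹' V.carrier)) = A ∪ {y | R y ≤ s} := by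
      ext y
      simp only [mem_univ, true_iff]
      exact le_total s (R y)
    rw [huniv]
    refine ContinuousOn.union_of_isClosed ?_ ?_ hA (isClosed_le hR continuous_const)
    · rw [continuousOn_iff_continuous_domRestrict]
      have h1 : Continuous fun a : A => ((Φ (1, a) : f ⁻¹' Lᶜ) : N) := by fun_prop
      refine h1.congr fun a => ?_
      simp [a.2]
    · refine continuous_subtype_val.continuousOn.congr fun y hy => ?_
      by_cases h : y ∈ A
      · rw [dif_pos h]
        exact hfix ⟨y, h⟩ (le_antisymm hy h)
      · rw [dif_neg h]
  · intro y
    beta_reduce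
    by_cases h : y ∈ A
    · rw [dif_pos h]
      have h2 := hΦ' (1, ⟨y, h⟩)
      have h3 : V.toFun (P (1, ⟨y, h⟩)) ∈ V.carrier := mem_range_self _
      refine ⟨h2 ▸ h3, ?_⟩
      have h4 : V.radius ⟨V.toFun (P (1, ⟨y, h⟩)), h3⟩ = s := by
        rw [V.radius_mk]
        refine (hnorm _).trans ?_
        simp [rad]
      simp only [h2, h4, le_refl]
    · rw [dif_neg h]
      exact ⟨y.2, (not_le.mp h).le⟩
  · intro y hy
    beta_reduce
    by_cases h : y ∈ A
    · rw [dif_pos h]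
      exact hfix ⟨y, h⟩ (le_antisymm hy h)
    · rw [dif_neg h]

/-- A component of the preimage of a tubular neighbourhood contains only one component of the
preimage of the core. -/
theorem IsBranchedCovering.component_eq_of_mem_tube [CompactSpace N] [T2Space N] [T2Space M]
    [ConnectedSpace N] (hf : IsBranchedCovering f L n) (hGal : IsGaloisOver f L)
    (V : TubularNbhd M) (hVL : V.carrier ∩ L ⊆ V.core) {C C' : Set N}
    (hC : C ∈ components (f ⁻¹' V.core)) (hC' : C' ∈ components (f ⁻¹' V.core)) {x x' : N}
    (hx : x ∈ C) (hx' : x' ∈ C') (h : x' ∈ connectedComponentIn (f ⁻¹' V.carrier) x) :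
    C = C' := by
  by_contra hne
  have hcore := V.isCompact_core.isClosed
  obtain ⟨U, hU, hUC⟩ := hf.exists_isOpen_inter_eq_component hGal hcore V.isPreconnected_core hC
  have hF : IsClosed (f ⁻¹' V.core) := hcore.preimage hf.continuous
  have hCc : IsCompact C := (components_isClosed hF hC).isCompact
  have hDc : IsCompact (f ⁻¹' V.core \ U) := (hF.sdiff hU).isCompact
  have hCD : Disjoint C (f ⁻¹' V.core \ U) := by
    rw [disjoint_left]
    rintro y hy ⟨-, hyU⟩
    exact hyU (hUC.ge hy).1
  obtain ⟨U₁, U₂, hU₁, hU₂, hCU₁, hDU₂, hdisj⟩ := SeparatedNhds.of_isCompact_isCompact hCc hDc hCD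
  have hFU : ∀ y, f y ∈ V.core → y ∈ U₁ ∪ U₂ := fun y hy => by
    by_cases hyU : y ∈ U
    · exact Or.inl (hCU₁ (hUC.le ⟨hyU, hy⟩))
    · exact Or.inr (hDU₂ ⟨hy, hyU⟩)
  have hcar : IsClosed (f ⁻¹' V.carrier) :=
    V.isCompact_carrier.isClosed.preimage hf.continuous
  have : CompactSpace (f ⁻¹' V.carrier) := isCompact_iff_compactSpace.mp hcar.isCompact
  let R : f ⁻¹' V.carrier → ℝ := fun y => V.radius ⟨f y, y.2⟩
  have hR : Continuous R :=
    V.continuous_radius.comp ((hf.continuous.comp continuous_subtype_val).subtype_mk _)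
  -- Half the minimal radius outside `U₁ ∪ U₂`; the minimum is positive since radius 0 means lying
  -- over the core, which `U₁ ∪ U₂` covers.
  have hs : ∃ s, 0 < s ∧ s ≤ 1 ∧ ∀ y : f ⁻¹' V.carrier, R y ≤ s → (y : N) ∈ U₁ ∪ U₂ := by
    have hZ : IsCompact (Subtype.val ⁻¹' (U₁ ∪ U₂)ᶜ : Set (f ⁻¹' V.carrier)) :=
      ((hU₁.union hU₂).isClosed_compl.preimage continuous_subtype_val).isCompact
    rcases (Subtype.val ⁻¹' (U₁ ∪ U₂)ᶜ : Set (f ⁻¹' V.carrier)).eq_empty_or_nonempty with h0 | h0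
    · refine ⟨1, one_pos, le_rfl, fun y _ => ?_⟩
      by_contra hy
      exact (h0 ▸ (show y ∈ Subtype.val ⁻¹' (U₁ ∪ U₂)ᶜ from hy) : y ∈ (∅ : Set _))
    · obtain ⟨y₀, hy₀, hmin⟩ := hZ.exists_isMinOn h0 hR.continuousOn
      have hpos : 0 < R y₀ := by
        refine lt_of_le_of_ne (norm_nonneg _) fun h1 => hy₀ (hFU _ ?_)
        exact V.radius_eq_zero_iff.mp h1.symm
      have h1 : R y₀ ≤ 1 := V.radius_le_one _
      refine ⟨R y₀ / 2, by linarith, by linarith, fun y hy => ?_⟩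
      by_contra hyU
      have : R y₀ ≤ R y := hmin hyU
      linarith
  obtain ⟨s, hs, hs1, hsU⟩ := hs
  obtain ⟨ρ, hρ, hρs, hρfix⟩ := hf.exists_radial_retraction V hVL hs hs1
  have hfixcore : ∀ y, (hy : f y ∈ V.core) → ρ ⟨y, V.core_subset_carrier hy⟩ = y := fun y hy =>
    hρfix ⟨y, _⟩ ((V.radius_eq_zero_iff (x := ⟨f y, V.core_subset_carrier hy⟩)).mpr hy ▸ hs.le)
  have hxc : f x ∈ V.core := components_subset hC hx
  have hxc' : f x' ∈ V.core := components_subset hC' hx'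
  rw [connectedComponentIn_eq_image (show x ∈ f ⁻¹' V.carrier from V.core_subset_carrier hxc)] at h
  obtain ⟨w, hw, hwx⟩ := h
  obtain rfl : w = ⟨x', V.core_subset_carrier hxc'⟩ := Subtype.ext hwx
  -- The retracted tube component is connected, lies in the disjoint open sets `U₁ ∪ U₂`, and still
  -- contains `x` and `x'`, one in each.
  have hT := (isPreconnected_connectedComponent
    (x := (⟨x, V.core_subset_carrier hxc⟩ : f ⁻¹' V.carrier))).image ρ hρ.continuousOn
  have hTU : ρ '' connectedComponent ⟨x, V.core_subset_carrier hxc⟩ ⊆ U₁ ∪ U₂ := by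
    rintro _ ⟨y, -, rfl⟩
    obtain ⟨h1, h2⟩ := hρs y
    exact hsU ⟨ρ y, h1⟩ h2
  have hxU : x' ∉ U := fun hxU =>
    hne (components_eq_of_mem hC hC' (hUC.le ⟨hxU, hxc'⟩) hx')
  obtain ⟨y, -, hy⟩ := hT U₁ U₂ hU₁ hU₂ hTU
    ⟨x, ⟨_, mem_connectedComponent, hfixcore x hxc⟩, hCU₁ hx⟩
    ⟨x', ⟨_, hw, hfixcore x' hxc'⟩, hDU₂ ⟨hxc', hxU⟩⟩
  exact hdisj.le_bot hy

end

/-! ### The boundary fibre as a torsor under the decomposition group -/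

section

variable {N M : Type*} [TopologicalSpace N] [TopologicalSpace M] {f : N → M} {L : Set M} {n : ℕ}

theorem tubeAbove_eq (V : TubularNbhd M) {C : Set N} (hC : C ∈ components (f ⁻¹' V.core)) {x : N}
    (hx : x ∈ C) : tubeAbove f V C = connectedComponentIn (f ⁻¹' V.carrier) x := by
  have hsub : C ⊆ connectedComponentIn (f ⁻¹' V.carrier) x :=
    (components_isPreconnected hC).subset_connectedComponentIn hx
      ((components_subset hC).trans (preimage_mono V.core_subset_carrier))
  ext y
  constructor
  · rintro ⟨x', hx', hy⟩
    rwa [← connectedComponentIn_eq (hsub hx')] at hy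
  · intro hy
    exact ⟨x, hx, hy⟩

theorem tubeAbove_mem_components (V : TubularNbhd M) {C : Set N}
    (hC : C ∈ components (f ⁻¹' V.core)) : tubeAbove f V C ∈ components (f ⁻¹' V.carrier) := by
  obtain ⟨x, hx⟩ := components_nonempty hC
  rw [tubeAbove_eq V hC hx]
  exact connectedComponentIn_mem_components (V.core_subset_carrier (components_subset hC hx))

theorem subset_tubeAbove (V : TubularNbhd M) {C : Set N} (hC : C ∈ components (f ⁻¹' V.core)) :
    C ⊆ tubeAbove f V C := fun _ hx =>
  ⟨_, hx, mem_connectedComponentIn (V.core_subset_carrier (components_subset hC hx))⟩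

theorem boundaryFibre_eq (V : TubularNbhd M) {b : M} (hb : b ∈ V.boundary) (C : Set N) :
    boundaryFibre f V b C = {y | f y = b ∧ y ∈ tubeAbove f V C} := by
  ext y
  constructor
  · rintro ⟨rfl, hy, -⟩
    exact ⟨rfl, hy⟩
  · rintro ⟨rfl, hy⟩
    exact ⟨rfl, hy, hb⟩

variable [CompactSpace N] [T2Space N] [T2Space M] [ConnectedSpace N]

/-- The decomposition group acts simply transitively on the boundary fibre. -/
theorem IsBranchedCovering.ncard_boundaryFibre (hf : IsBranchedCovering f L n)
    (hGal : IsGaloisOver f L) (V : TubularNbhd M) (hVL : V.carrier ∩ L ⊆ V.core) {b : M}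
    (hb : b ∈ V.boundary) {C : Set N} (hC : C ∈ components (f ⁻¹' V.core)) :
    (boundaryFibre f V b C).ncard = Nat.card (decompositionGroup f C) := by
  have hbV : b ∈ V.carrier := V.boundary_subset_carrier hb
  have hbL : b ∉ L := fun h => disjoint_left.mp V.disjoint_boundary_core hb (hVL ⟨hbV, h⟩)
  have hT := tubeAbove_mem_components V hC
  obtain ⟨y, hyT, rfl⟩ := hf.exists_mem_component V.isCompact_carrier.isClosed
    V.isPreconnected_carrier hT hbV
  have horb : MulAction.orbit (decompositionGroup f C) y = boundaryFibre f V (f y) C := by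
    rw [boundaryFibre_eq V hb]
    ext y'
    constructor
    · rintro ⟨σ, rfl⟩
      have hσC : ((σ : Gal f) : N ≃ₜ N) '' C = C := σ.2
      obtain ⟨x, hx⟩ := components_nonempty hC
      have hσx : ((σ : Gal f) : N ≃ₜ N) x ∈ C := hσC.subset (mem_image_of_mem _ hx)
      have hσT := gal_image_eq_of_mem (σ : Gal f).2 hT hT (subset_tubeAbove V hC hx)
        (subset_tubeAbove V hC hσx)
      exact ⟨(σ : Gal f).2 y, hσT.subset (mem_image_of_mem _ hyT)⟩
    -- A transformation between points of the tube preserves the tube, so it sends `C` to a core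
    -- component in the same tube, which must be `C`.
    · rintro ⟨hy', hyT'⟩
      obtain ⟨σ, rfl⟩ := hf.exists_apply_eq hGal hy'
      have hσT := gal_image_eq_of_mem σ.2 hT hT hyT hyT'
      obtain ⟨x, hx⟩ := components_nonempty hC
      have hσx : (σ : N ≃ₜ N) x ∈ tubeAbove f V C :=
        hσT.subset (mem_image_of_mem _ (subset_tubeAbove V hC hx))
      rw [tubeAbove_eq V hC hx] at hσx
      have hσC := hf.component_eq_of_mem_tube hGal V hVL hC (gal_image_mem_components σ.2 hC) hx
        (mem_image_of_mem _ hx) hσx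
      exact ⟨⟨σ, hσC.symm⟩, rfl⟩
  have hstab : MulAction.stabilizer (decompositionGroup f C) y = ⊥ := by
    refine (Subgroup.eq_bot_iff_forall _).mpr fun σ hσ => Subtype.ext (Subtype.ext ?_)
    exact hf.eq_one_of_apply_eq (σ : Gal f).2 hbL hσ
  rw [← horb, ← MulAction.index_stabilizer, hstab, Subgroup.index_bot]

omit [CompactSpace N] [ConnectedSpace N] [T2Space N] [T2Space M] in
theorem IsBranchedCovering.isLocallyInjectiveOver (hf : IsBranchedCovering f L n) {K : Set M}
    (hKL : K ∈ components L ∨ Disjoint K L) : IsLocallyInjectiveOver f K := by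
  intro y hy
  rcases hKL with hK | hK
  · have hKL := components_subset hK
    obtain ⟨W, hWo, hyW, hW⟩ := (hf.isBranchedAt y (hKL hy)).exists_injOn
    exact ⟨W, hWo, hyW, hW.mono (inter_subset_inter_right _ (preimage_mono hKL))⟩
  · obtain ⟨W, hWo, hyW, hW⟩ := hf.exists_injOn (disjoint_left.mp hK hy)
    exact ⟨W, hWo, hyW, hW.mono inter_subset_left⟩

end
end HilbertKnots

/-! ### Assembling the counts -/

open HilbertKnots in
theorem theorem6p1p1
    {M N : Type*}
    [TopologicalSpace M] [T2Space M] [CompactSpace M] [ConnectedSpace M]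
    [ChartedSpace (EuclideanSpace ℝ (Fin 3)) M]
    [TopologicalSpace N] [T2Space N] [CompactSpace N] [ConnectedSpace N]
    [ChartedSpace (EuclideanSpace ℝ (Fin 3)) N]
    (f : N → M) (L : Set M) (n : ℕ)
    (hf : IsBranchedCovering f L n) (hGal : IsGaloisOver f L)
    (K : Set M) (V : TubularNbhd M) (hVK : V.core = K)
    (hKL : K ∈ components L ∨ Disjoint K L) (hVL : V.carrier ∩ L ⊆ K)
    (b : M) (hb : b ∈ V.boundary) :
    ∃ e d : ℕ, 0 < e ∧ 0 < d ∧
      n = e * d * (components (f ⁻¹' K)).ncard ∧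
      ∀ (C : Set N) (hC : C ∈ components (f ⁻¹' K)),
        IsCoveringOfDegree
          (fun y : C => (⟨f y, components_subset hC y.2⟩ : K)) d ∧
        ramificationIndex f V b C d = e ∧
        IsShortExact (inertiaGroup f C).subtype (restrictHom f C) ∧
        Nat.card (inertiaGroup f C) = e ∧
        Nat.card (decompositionGroup f C) = e * d := by
  subst hVK
  have hinj := hf.isLocallyInjectiveOver hKL
  have hK := V.isCompact_core.isClosed
  have hKc := V.isPreconnected_core
  obtain ⟨x₀, hx₀⟩ := V.core_nonempty
  obtain ⟨y₀, hy₀⟩ := hf.surjective x₀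
  have hC₀ := connectedComponentIn_mem_components
    (show y₀ ∈ f ⁻¹' V.core by rw [mem_preimage, hy₀]; exact hx₀)
  set C₀ := connectedComponentIn (f ⁻¹' V.core) y₀
  have hn := (hf.card_gal hGal).2
  have hr := hf.card_decompositionGroup_mul hGal hK hKc hC₀
  have hrpos : 0 < (components (f ⁻¹' V.core)).ncard :=
    Nat.pos_of_ne_zero fun h => hn.ne' (by rw [← hr, h, mul_zero])
  have hed := hf.card_inertiaGroup_mul hGal hK hKc hinj hC₀ hx₀
  -- Positivity of all factors comes from `0 < n`, since `n` is their product.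
  have hpos : 0 < Nat.card (inertiaGroup f C₀) * (C₀ ∩ f ⁻¹' {x₀}).ncard :=
    Nat.pos_of_ne_zero fun h => hn.ne' (by rw [← hr, ← hed, h, zero_mul])
  have hepos := Nat.pos_of_mul_pos_right hpos
  have hdpos := Nat.pos_of_mul_pos_left hpos
  refine ⟨Nat.card (inertiaGroup f C₀), (C₀ ∩ f ⁻¹' {x₀}).ncard, hepos, hdpos, ?_, ?_⟩
  · rw [hed, hr]
  · intro C hC
    -- Independence of the component: #D · r = n for every `C`, and `r` cancels; for `I` the common
    -- fibre count cancels likewise.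
    have hD : Nat.card (decompositionGroup f C) =
        Nat.card (inertiaGroup f C₀) * (C₀ ∩ f ⁻¹' {x₀}).ncard := by
      rw [hed]
      exact Nat.eq_of_mul_eq_mul_right hrpos
        ((hf.card_decompositionGroup_mul hGal hK hKc hC).trans hr.symm)
    have hI : Nat.card (inertiaGroup f C) = Nat.card (inertiaGroup f C₀) := by
      have h := hf.card_inertiaGroup_mul hGal hK hKc hinj hC hx₀
      rw [hf.ncard_component_inter_fibre hGal hK hKc hC₀ hC, hD] at h
      exact Nat.eq_of_mul_eq_mul_right hdpos h
    refine ⟨⟨hf.isCoveringMap_component hGal hK hKc hinj hC, ?_⟩, ?_,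
      ⟨Subtype.val_injective, range_subtype_inertiaGroup_eq_ker f C,
        hf.restrictHom_surjective hGal hK hKc hinj hC⟩, hI, hD⟩
    · rintro ⟨x, hx⟩
      have himg : (fun y : C => (⟨f y, components_subset hC y.2⟩ : V.core)) ⁻¹' {⟨x, hx⟩} =
          (Subtype.val ⁻¹' (f ⁻¹' {x}) : Set C) := by
        ext y
        exact Subtype.ext_iff
      have hfin : (C ∩ f ⁻¹' {x}).Finite :=
        (hf.finite_fibre hGal x).subset inter_subset_right
      rw [himg, ← Subtype.val_injective.encard_image, Subtype.image_preimage_coe,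
        ← hfin.cast_ncard_eq]
      -- #I · #(C ∩ f⁻¹(x)) = #D at every `x` in `K`, so cancelling #I shows that the fibre size is
      -- constant.
      have h := hf.card_inertiaGroup_mul hGal hK hKc hinj hC hx
      rw [hI, hD] at h
      exact congrArg Nat.cast (Nat.eq_of_mul_eq_mul_left hepos h)
    · rw [ramificationIndex, hf.ncard_boundaryFibre hGal V hVL hb hC, hD, Nat.cast_mul]
      exact mul_div_cancel_right₀ _ (Nat.cast_ne_zero.mpr hdpos.ne')
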